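/- Let $V$ be a valuation domain of rank one that is not a discrete valuation ring, let $K$ be its quotient field, and let $v\colon K\to\mathbb{R}\cup\{\infty\}$ be a (real-valued, additively written) valuation with valuation ring $V$ and value group $\Gamma_v\subseteq\mathbb{R}$; put $\mathbb{Q}\Gamma_v=\{q\gamma\mid q\in\mathbb{Q},\gamma\in\Gamma_v\}$. Let $\overline{K}$ be an algebraic closure of $K$, let $u\colon\overline{K}\to\mathbb{R}\cup\{\infty\}$ be a valuation extending $v$, and let $\beta\in\overline{K}$. A sequence $E=\{s_n\}_{n\in\mathbb{N}}\subseteq K$ is pseudo-convergent if $v(s_{n+1}-s_n)<v(s_{n+2}-s_{n+1})$ for all $n$; its breadth is $\delta_E=\lim_{n\to\infty}v(s_{n+1}-s_n)\in\mathbb{R}\cup\{\infty\}$; the element $\beta$ is a pseudo-limit of $E$ if $u(\beta-s_n)<u(\beta-s_{n+1})$ for all $n$. Put $$V_E=\{\phi\in K(X)\mid \phi(s_n)\in V\text{ for all but finitely many }n\}.$$ Let $\mathrm{Zar}(K(X)|V)$ be the set of valuation domains of $K(X)$ (with quotient field $K(X)$) containing $V$, with the Zariski topology, i.e. the topology generated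 by the sets $B(\phi)=\{W\mid\phi\in W\}$, $\phi\in K(X)$. For every pseudo-convergent sequence $E\subseteq K$ having $\beta$ as a pseudo-limit, $V_E$ belongs to $\mathrm{Zar}(K(X)|V)$; let $\mathcal{V}(\beta,\bullet)\subseteq\mathrm{Zar}(K(X)|V)$ be the subspace of all these $V_E$. Let $\delta(\beta,K)=\sup\{u(\beta-x)\mid x\in K\}\in\mathbb{R}\cup\{\infty\}$, and endow the interval $(-\infty,\delta(\beta,K)]$ with the $\mathbb{Q}\Gamma_v$-upper limit topology, i.e. the topology generated by the sets $(\alpha,\lambda]\cap(-\infty,\delta(\beta,K)]$ with $\alpha\in(-\infty,\delta(\beta,K)]$ and $\lambda\in\mathbb{Q}\Gamma_v\cup\{\infty\}$. Then the map $V_E\mapsto\delta_E$ is well defined (if $W\in\mathcal{V}(\beta,\bullet)$, then every pseudo-convergent sequence $E\subseteq K$ with $V_E=W$ has the same breadth $\delta_E$), and it is a homeomorphism from $\mathcal{V}(\beta,\bullet)$ onto $(-\infty,\delta(\beta,K)]$. -/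

import Mathlib

open Filter Topology

/-! ### The Zariski space of a valuation domain -/

/-- The Zariski space `Zar(L|V)`: the valuation domains of `L` (with quotient field `L`)
that contain `V`. -/
def Zar {K : Type*} [Field K] (V : ValuationSubring K) (L : Type*) [Field L] [Algebra K L] :
    Type _ :=
  {W : ValuationSubring L // ∀ x ∈ V, algebraMap K L x ∈ W}

namespace Zar

variable {K : Type*} [Field K] {V : ValuationSubring K} {L : Type*} [Field L] [Algebra K L]

/-- The valuation domain underlying a point of the Zariski space. -/
def ring (W : Zar V L) : ValuationSubring L := W.1

/-- The subbasic open set `B(φ) = {W | φ ∈ W}`. -/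
def basicOpen (V : ValuationSubring K) (φ : L) : Set (Zar V L) := {W | φ ∈ W.ring}

/-- The Zariski topology. -/
instance instTopologicalSpace : TopologicalSpace (Zar V L) :=
  TopologicalSpace.generateFrom (Set.range (basicOpen (L := L) V))

end Zar

/-! ### Pseudo-convergent sequences

Valuations of rank one are written additively, with values in `ℝ ∪ {∞} = WithTop ℝ`. -/

/-- `s` is pseudo-convergent: `v(s_{n+1} - s_n) < v(s_{n+2} - s_{n+1})` for all `n`. -/
def IsPseudoConvergent {K : Type*} [Field K] (v : AddValuation K (WithTop ℝ)) (s : ℕ → K) : Prop :=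
  ∀ n, v (s (n + 1) - s n) < v (s (n + 2) - s (n + 1))

/-- `β ∈ F` is a pseudo-limit, with respect to the valuation `u` of the extension `F` of `K`,
of the sequence `s` of `K`: `u(β - s_n) < u(β - s_{n+1})` for all `n`. -/
def IsPseudoLimit {K F : Type*} [Field K] [Field F] [Algebra K F]
    (u : AddValuation F (WithTop ℝ)) (s : ℕ → K) (β : F) : Prop :=
  ∀ n, u (β - algebraMap K F (s n)) < u (β - algebraMap K F (s (n + 1)))

/-- The breadth `δ_E = lim v(s_{n+1} - s_n)`, an element of `ℝ ∪ {∞}`. -/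
noncomputable def breadth {K : Type*} [Field K] (v : AddValuation K (WithTop ℝ)) (s : ℕ → K) :
    WithTop ℝ :=
  limUnder atTop (fun n => v (s (n + 1) - s n))

/-- The limit that defines the breadth exists for a pseudo-convergent sequence. -/
theorem IsPseudoConvergent.tendsto_breadth {K : Type*} [Field K]
    {v : AddValuation K (WithTop ℝ)} {s : ℕ → K} (hs : IsPseudoConvergent v s) :
    Tendsto (fun n => v (s (n + 1) - s n)) atTop (𝓝 (breadth v s)) := by
  have hm : Monotone (fun n => v (s (n + 1) - s n)) :=
    monotone_nat_of_le_succ fun n => (hs n).le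
  exact tendsto_nhds_limUnder
    ⟨_, tendsto_atTop_isLUB hm (isLUB_ciSup (OrderTop.bddAbove _))⟩

/-- `V_E`: the rational functions `φ` over `K` such that `φ(s_n)` is defined and belongs to `V`
for all but finitely many `n`. -/
def ringOfSeq {K : Type*} [Field K] (V : ValuationSubring K) (s : ℕ → K) : Set (RatFunc K) :=
  {φ | ∀ᶠ n in atTop, φ.denom.eval (s n) ≠ 0 ∧ φ.eval (RingHom.id K) (s n) ∈ V}

/-- `𝒱(β, •)`: the points `V_E` of `Zar(K(X)|V)` that are induced by a pseudo-convergent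
sequence `E` of `K` having `β` as a pseudo-limit with respect to `u`. It carries the subspace
topology of the Zariski topology. -/
def fixedPseudoLimit {K F : Type*} [Field K] [Field F] [Algebra K F] (V : ValuationSubring K)
    (v : AddValuation K (WithTop ℝ)) (u : AddValuation F (WithTop ℝ)) (β : F) :
    Set (Zar V (RatFunc K)) :=
  {W | ∃ s : ℕ → K, IsPseudoConvergent v s ∧ IsPseudoLimit u s β ∧
    (W.ring : Set (RatFunc K)) = ringOfSeq V s}

/-- `δ(β, K) = sup {u(β - x) | x ∈ K}`, an element of `ℝ ∪ {∞}`. -/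
noncomputable def distToBase (K : Type*) {F : Type*} [Field K] [Field F] [Algebra K F]
    (u : AddValuation F (WithTop ℝ)) (β : F) : WithTop ℝ :=
  ⨆ x : K, u (β - algebraMap K F x)

/-- The supremum that defines `δ(β, K)` is a genuine least upper bound. -/
theorem isLUB_distToBase (K : Type*) {F : Type*} [Field K] [Field F] [Algebra K F]
    (u : AddValuation F (WithTop ℝ)) (β : F) :
    IsLUB (Set.range fun x : K => u (β - algebraMap K F x)) (distToBase K u β) :=
  isLUB_ciSup (OrderTop.bddAbove _)

/-- `ℚΓ_v = {q γ | q ∈ ℚ, γ ∈ Γ_v} ⊆ ℝ`, where `Γ_v ⊆ ℝ` is the set of finite values of `v`. -/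
def ratValues {K : Type*} [Field K] (v : AddValuation K (WithTop ℝ)) : Set ℝ :=
  {r | ∃ (q : ℚ) (γ : ℝ), (∃ x : K, v x = (γ : WithTop ℝ)) ∧ r = (q : ℝ) * γ}

/-- The interval `(-∞, b]`, for `b ∈ ℝ ∪ {∞}`, to be endowed with the `Λ`-upper limit topology. -/
@[ext]
structure UpperLimit (b : WithTop ℝ) (Λ : Set ℝ) where
  /-- the underlying element of `ℝ ∪ {∞}` -/
  val : WithTop ℝ
  le_bound : val ≤ b

/-- The `Λ`-upper limit topology on `(-∞, b]`, generated by the sets `(α, l]` with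
`l ∈ Λ ∪ {∞}` and `α ∈ (-∞, b]`. -/
instance UpperLimit.instTopologicalSpace (b : WithTop ℝ) (Λ : Set ℝ) :
    TopologicalSpace (UpperLimit b Λ) :=
  TopologicalSpace.generateFrom
    {S | ∃ α l : WithTop ℝ, α ≤ b ∧ (l = ⊤ ∨ ∃ r ∈ Λ, l = (r : WithTop ℝ)) ∧
      S = {x : UpperLimit b Λ | α < x.val ∧ x.val ≤ l}}

/-!
The ring `V_E` attached to a pseudo-convergent sequence `E = (sₙ)` with pseudo-limit `β` is
governed by the distances `u (β - sₙ) = v (sₙ₊₁ - sₙ)`, which increase strictly to the breadth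
`δ_E`. A larger value of `u (β - x)` means that `x` is closer to `β`; the value is called the
distance all the same.

Factor a rational function `φ` over the algebraic closure. A root or pole `α` contributes to `v (φ
x)` the quantity `u (x - α) = min (u (x - β)) (u (β - α))` whenever the two terms differ. Hence,
as long as `t = u (x - β)` stays away from the finitely many values `u (β - α)`, `v (φ x) = c + k
t` is an affine function of `t`, with `k` an integer and `c` a value of `u`
(`exists_eventually_map_ratFunc_eval`). On an interval `(a, δ_E)` this shows that `V_E` is a
valuation ring and depends only on `β` and `δ_E`, so that `V_E ↦ δ_E` is injective. Conversely
`δ_E` can be read off the functions `(X - a) / c` in `V_E`, so the map is well defined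
(`breadth_eq_of_ringOfSeq_eq`). It is onto since the value group is dense in `ℝ`
(`dense_valueAddSubgroup`, `exists_breadth_eq`).

The map is continuous because `δ_E > α` is detected by the functions `(X - a) / c` with `v c > α`,
and `δ_E ≤ l` by a function `c / (X - x)ᵐ` with `v c = m l`
(`exists_mem_ringOfSeq_iff_breadth_le`); the latter is where `l` must be in `ℚΓ_v`. For the
inverse, let `φ ∈ V_E`. Then `φ` stays in the ring when the breadth is decreased slightly. If `δ_E
∈ ℚΓ_v ∪ {∞}`, this gives a neighbourhood `(a, δ_E]`. Otherwise `δ_E` differs from all the values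
`u (β - α)`, which lie in `ℚΓ_v ∪ {∞}`, so that `c + k t` describes `v (φ x)` on both sides of
`δ_E`; as `c ∈ ℚΓ_v` too, it does not vanish at `δ_E` unless it is identically zero, and its sign
is constant near `δ_E` (`exists_forall_mem_of_mem_ringOfSeq`).
-/

/-! ### The value group -/

/-- The finite values of `v`, as a subgroup of `ℝ`. -/
def valueAddSubgroup {K : Type*} [Field K] (v : AddValuation K (WithTop ℝ)) : AddSubgroup ℝ where
  carrier := {r | ∃ x : K, v x = (r : WithTop ℝ)}
  zero_mem' := ⟨1, by simp⟩
  add_mem' := by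
    rintro a b ⟨x, hx⟩ ⟨y, hy⟩
    exact ⟨x * y, by simp [hx, hy]⟩
  neg_mem' := by
    rintro a ⟨x, hx⟩
    refine ⟨x⁻¹, ?_⟩
    rw [AddValuation.map_inv, hx]
    rfl

lemma AddValuation.exists_coe_eq {K : Type*} [Field K] (v : AddValuation K (WithTop ℝ)) {x : K}
    (hx : x ≠ 0) : ∃ r : ℝ, v x = (r : WithTop ℝ) := by
  obtain ⟨r, hr⟩ := WithTop.ne_top_iff_exists.1 ((v.ne_top_iff).2 hx)
  exact ⟨r, hr.symm⟩

lemma AddValuation.ne_zero_of_eq_coe {K : Type*} [Field K] (v : AddValuation K (WithTop ℝ)) {x : K}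
    {r : ℝ} (hx : v x = (r : WithTop ℝ)) : x ≠ 0 := by
  rintro rfl
  simp at hx

/-- A valuation ring whose value group is generated by a positive real is discrete: an element of
value the generator is a uniformizer. -/
lemma isDiscreteValuationRing_of_zmultiples {K : Type*} [Field K] (V : ValuationSubring K)
    (v : AddValuation K (WithTop ℝ)) (hv : ∀ x : K, x ∈ V ↔ 0 ≤ v x) {a : ℝ} (ha : 0 < a)
    (hmem : a ∈ valueAddSubgroup v) (hcyc : ∀ r ∈ valueAddSubgroup v, ∃ n : ℤ, r = n * a) :
    IsDiscreteValuationRing V := by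
  obtain ⟨p, hp⟩ : ∃ x : K, v x = (a : WithTop ℝ) := hmem
  have hp0 : p ≠ 0 := v.ne_zero_of_eq_coe hp
  have hval : ∀ x ∈ V, x ≠ 0 → ∃ n : ℕ, v x = ((n * a : ℝ) : WithTop ℝ) := by
    intro x hx hx0
    obtain ⟨r, hr⟩ := v.exists_coe_eq hx0
    obtain ⟨n, rfl⟩ := hcyc r ⟨x, hr⟩
    rw [hv, hr] at hx
    have hx' : (0 : ℝ) ≤ n * a := by exact_mod_cast hx
    have hn : (0 : ℝ) ≤ n := nonneg_of_mul_nonneg_left hx' ha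
    lift n to ℕ using (by exact_mod_cast hn)
    exact ⟨n, by rw [hr]; simp⟩
  have hunit : ∀ x : V, v (x : K) = 0 → IsUnit x := by
    intro x hx
    have hx0 : (x : K) ≠ 0 := v.ne_zero_of_eq_coe (r := 0) (by simpa using hx)
    have hinv : (x : K)⁻¹ ∈ V := by
      rw [hv, AddValuation.map_inv, hx]
      exact le_of_eq (by norm_cast; simp)
    exact IsUnit.of_mul_eq_one ⟨_, hinv⟩ (Subtype.ext (mul_inv_cancel₀ hx0))
  have hpV : p ∈ V := by
    rw [hv, hp]
    exact_mod_cast ha.le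
  have hnonunit : ∀ x : V, IsUnit x → v (x : K) = 0 := by
    intro x hx
    obtain ⟨y, hy⟩ := hx.exists_right_inv
    have h1 : v (x : K) + v (y : K) = 0 := by
      rw [← v.map_mul, ← v.map_one]
      exact congrArg v (congrArg Subtype.val hy)
    exact le_antisymm (h1 ▸ le_add_of_nonneg_right ((hv _).1 y.2)) ((hv _).1 x.2)
  refine IsDiscreteValuationRing.ofHasUnitMulPowIrreducibleFactorization
    ⟨⟨p, hpV⟩, ⟨fun h => ?_, ?_⟩, ?_⟩
  · have := hnonunit _ h
    rw [show ((⟨p, hpV⟩ : V) : K) = p from rfl, hp] at this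
    exact ha.ne' (by exact_mod_cast this)
  · intro x y hxy
    have hxy' : p = (x : K) * y := congrArg Subtype.val hxy
    have hx0 : (x : K) ≠ 0 := by
      intro h
      rw [h, zero_mul] at hxy'
      exact hp0 hxy'
    have hy0 : (y : K) ≠ 0 := by
      intro h
      rw [h, mul_zero] at hxy'
      exact hp0 hxy'
    obtain ⟨n, hn⟩ := hval x x.2 hx0
    obtain ⟨m, hm⟩ := hval y y.2 hy0
    rw [hxy', v.map_mul, hn, hm] at hp
    have h1 : (n : ℝ) * a + m * a = a := by exact_mod_cast hp
    have h2 : ((n + m : ℕ) : ℝ) = (1 : ℕ) := by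
      apply mul_right_cancel₀ ha.ne'
      push_cast
      linarith
    have h3 : n + m = 1 := by exact_mod_cast h2
    rcases Nat.eq_zero_or_pos n with rfl | hn0
    · exact Or.inl (hunit _ (by rw [hn]; simp))
    · obtain rfl : m = 0 := by omega
      exact Or.inr (hunit _ (by rw [hm]; simp))
  · intro x hx
    have hx0 : (x : K) ≠ 0 := fun h => hx (Subtype.ext h)
    obtain ⟨n, hn⟩ := hval x x.2 hx0
    have hpn : v (p ^ n) = ((n * a : ℝ) : WithTop ℝ) := by
      rw [v.map_pow, hp, ← WithTop.coe_nsmul, nsmul_eq_mul]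
    have hq : v ((x : K) / p ^ n) = 0 := by
      rw [AddValuation.map_div, hn, hpn]
      norm_cast
      simp
    have hqV : (x : K) / p ^ n ∈ V := by rw [hv, hq]
    refine ⟨n, (hunit ⟨_, hqV⟩ hq).unit, Subtype.ext ?_⟩
    simp only [IsUnit.unit_spec, MulMemClass.coe_mul, SubmonoidClass.coe_pow]
    field_simp

/-- The value group of a non-discrete valuation domain of rank one is dense in `ℝ`. -/
theorem dense_valueAddSubgroup {K : Type*} [Field K] (V : ValuationSubring K)
    (hrank : ringKrullDim V = 1) (hdisc : ¬ IsDiscreteValuationRing V)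
    (v : AddValuation K (WithTop ℝ)) (hv : ∀ x : K, x ∈ V ↔ 0 ≤ v x) :
    Dense (valueAddSubgroup v : Set ℝ) := by
  refine (AddSubgroup.dense_or_cyclic _).resolve_right ?_
  rintro ⟨a, ha⟩
  have hmem : a ∈ valueAddSubgroup v := by
    rw [ha]
    exact AddSubgroup.subset_closure rfl
  have hcyc : ∀ r ∈ valueAddSubgroup v, ∃ n : ℤ, r = n * a := by
    intro r hr
    rw [ha, AddSubgroup.mem_closure_singleton] at hr
    obtain ⟨n, rfl⟩ := hr
    exact ⟨n, by simp⟩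
  rcases lt_trichotomy a 0 with h | rfl | h
  · refine hdisc (isDiscreteValuationRing_of_zmultiples V v hv (neg_pos.2 h) (neg_mem hmem) ?_)
    intro r hr
    obtain ⟨n, rfl⟩ := hcyc r hr
    exact ⟨-n, by push_cast; ring⟩
  · have hfield : IsField V := by
      refine ⟨⟨0, 1, zero_ne_one⟩, mul_comm, fun {x} hx => ?_⟩
      have hx0 : (x : K) ≠ 0 := fun h => hx (Subtype.ext h)
      obtain ⟨r, hr⟩ := v.exists_coe_eq hx0
      obtain ⟨n, rfl⟩ := hcyc r ⟨x, hr⟩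
      refine ⟨⟨(x : K)⁻¹, ?_⟩, Subtype.ext (mul_inv_cancel₀ hx0)⟩
      rw [hv, AddValuation.map_inv, hr, mul_zero]
      exact le_of_eq (by norm_cast)
    rw [ringKrullDim_eq_zero_of_isField hfield] at hrank
    exact zero_ne_one hrank
  · exact hdisc (isDiscreteValuationRing_of_zmultiples V v hv h hmem hcyc)

lemma exists_value_between {K : Type*} [Field K] {v : AddValuation K (WithTop ℝ)}
    (hd : Dense (valueAddSubgroup v : Set ℝ)) {a b : WithTop ℝ} (hab : a < b) :
    ∃ (x : K) (r : ℝ), v x = (r : WithTop ℝ) ∧ a < r ∧ (r : WithTop ℝ) < b := by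
  obtain ⟨a, rfl⟩ := WithTop.ne_top_iff_exists.1 hab.ne_top
  obtain ⟨c, hac, hcb⟩ := exists_between hab
  obtain ⟨c, rfl⟩ := WithTop.ne_top_iff_exists.1 hcb.ne_top
  obtain ⟨r, ⟨x, hx⟩, h1, h2⟩ := hd.exists_between (WithTop.coe_lt_coe.1 hac)
  exact ⟨x, r, hx, WithTop.coe_lt_coe.2 h1, (WithTop.coe_lt_coe.2 h2).trans hcb⟩

lemma coe_mem_ratValues {K : Type*} [Field K] {v : AddValuation K (WithTop ℝ)} {x : K} {r : ℝ}
    (hx : v x = (r : WithTop ℝ)) : r ∈ ratValues v :=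
  ⟨1, r, ⟨x, hx⟩, by simp⟩

lemma mul_mem_ratValues {K : Type*} [Field K] {v : AddValuation K (WithTop ℝ)} {r : ℝ}
    (hr : r ∈ ratValues v) (q : ℚ) : (q : ℝ) * r ∈ ratValues v := by
  obtain ⟨q', γ, hγ, rfl⟩ := hr
  exact ⟨q * q', γ, hγ, by push_cast; ring⟩

/-- The value of a nonzero algebraic element `y` is rational over the value group of the base: in
an algebraic equation `∑ aᵢ yⁱ = 0` two terms have the same value. -/
theorem mem_ratValues_of_isAlgebraic {K F : Type*} [Field K] [Field F] [Algebra K F]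
    {v : AddValuation K (WithTop ℝ)} {u : AddValuation F (WithTop ℝ)}
    (hu : ∀ x : K, u (algebraMap K F x) = v x) {y : F} (hy : IsAlgebraic K y) {r : ℝ}
    (hr : u y = (r : WithTop ℝ)) : r ∈ ratValues v := by
  obtain ⟨p, hp0, hp⟩ := hy
  by_contra hcon
  let f : ℕ → F := fun i => algebraMap K F (p.coeff i) * y ^ i
  have hval : ∀ i ∈ p.support, ∃ g : ℝ, v (p.coeff i) = (g : WithTop ℝ) ∧
      u (f i) = ((g + i * r : ℝ) : WithTop ℝ) := by
    intro i hi
    obtain ⟨g, hg⟩ := v.exists_coe_eq (Polynomial.mem_support_iff.1 hi)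
    refine ⟨g, hg, ?_⟩
    rw [u.map_mul, hu, hg, u.map_pow, hr, ← WithTop.coe_nsmul, nsmul_eq_mul, WithTop.coe_add]
  have hinj : ∀ i ∈ p.support, ∀ j ∈ p.support, u (f i) = u (f j) → i = j := by
    intro i hi j hj hij
    obtain ⟨g, hg, hfi⟩ := hval i hi
    obtain ⟨g', hg', hfj⟩ := hval j hj
    rw [hfi, hfj] at hij
    have h1 : g + i * r = g' + j * r := by exact_mod_cast hij
    by_contra hne
    have hne' : (j : ℝ) - i ≠ 0 := sub_ne_zero.2 fun h => hne (by exact_mod_cast h.symm)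
    have hmem : g - g' ∈ valueAddSubgroup v := sub_mem ⟨_, hg⟩ ⟨_, hg'⟩
    obtain ⟨x, hx⟩ := hmem
    refine hcon ⟨((j : ℚ) - i)⁻¹, g - g', ⟨x, hx⟩, ?_⟩
    push_cast
    field_simp
    linarith
  obtain ⟨i, hi, hmin⟩ := Finset.exists_min_image p.support (fun i => u (f i))
    (Polynomial.support_nonempty.2 hp0)
  have hsum : f i + ∑ j ∈ p.support.erase i, f j = 0 := by
    rw [Finset.add_sum_erase _ f hi, ← hp, Polynomial.aeval_def, Polynomial.eval₂_eq_sum,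
      Polynomial.sum_def]
  obtain ⟨g, -, hfi⟩ := hval i hi
  have hlt : u (f i) < u (∑ j ∈ p.support.erase i, f j) := by
    refine u.map_lt_sum (by rw [hfi]; exact WithTop.coe_ne_top) fun j hj => ?_
    have hj' := Finset.mem_of_mem_erase hj
    exact lt_of_le_of_ne (hmin j hj') fun h => Finset.ne_of_mem_erase hj (hinj i hi j hj' h).symm
  rw [← neg_eq_of_add_eq_zero_right hsum, u.map_neg] at hlt
  exact lt_irrefl _ hlt

/-! ### Values of rational functions at a given distance from `β` -/

/-- Let `l` be a filter on `ℝ ∪ {∞}` that lies, eventually, on one side of each value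
`u (β - α)`. Then the value of a
polynomial at `x` is an affine function of
`t = u (β - x)`, for `l`-almost all `t`: a root `α` with `u (β - α) < t` contributes the constant
`u (β - α)`, and a root with `u (β - α) > t` contributes `t` itself. -/
theorem Polynomial.Splits.exists_eventually_map_eval {F : Type*} [Field F]
    (u : AddValuation F (WithTop ℝ)) (β : F) {l : Filter (WithTop ℝ)} [l.NeBot]
    (hl : ∀ α : F, (∀ᶠ t in l, t < u (β - α)) ∨ ∀ᶠ t in l, u (β - α) < t)
    {p : Polynomial F} (hp : p.Splits) (hp0 : p ≠ 0) :
    ∃ (y : F) (k : ℕ), y ≠ 0 ∧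
      ∀ᶠ t in l, ∀ x : F, u (β - x) = t → u (p.eval x) = u y + k • t := by
  induction hp using Submonoid.closure_induction with
  | mem p hp =>
    rcases hp with ⟨a, rfl⟩ | ⟨a, rfl⟩
    · exact ⟨a, 0, by simpa using hp0, Eventually.of_forall fun t x _ => by simp⟩
    · rcases hl (-a) with h | h
      · refine ⟨1, 1, one_ne_zero, h.mono fun t ht x hx => ?_⟩
        rw [← hx] at ht ⊢
        have : (Polynomial.X + Polynomial.C a).eval x = (β - -a) - (β - x) := by simp; ring
        rw [this, u.map_sub_eq_of_lt_right ht]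
        simp
      · refine ⟨β - -a, 0, ?_, h.mono fun t ht x hx => ?_⟩
        · obtain ⟨t, ht⟩ := h.exists
          exact u.ne_top_iff.1 ht.ne_top
        · rw [← hx] at ht
          have : (Polynomial.X + Polynomial.C a).eval x = (β - -a) - (β - x) := by simp; ring
          rw [this, u.map_sub_eq_of_lt_left ht]
          simp
  | one => exact ⟨1, 0, one_ne_zero, Eventually.of_forall fun t x _ => by simp⟩
  | mul p q _ _ ihp ihq =>
    obtain ⟨y, k, hy, h⟩ := ihp (left_ne_zero_of_mul hp0)
    obtain ⟨y', k', hy', h'⟩ := ihq (right_ne_zero_of_mul hp0)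
    refine ⟨y * y', k + k', mul_ne_zero hy hy', ?_⟩
    filter_upwards [h, h'] with t h h' x hx
    rw [Polynomial.eval_mul, u.map_mul, h x hx, h' x hx, u.map_mul, add_nsmul, add_add_add_comm]

/-- The value of a rational function `φ` over `K` at a point `x` of `K` is an affine function of
`u (β - x)`, for `l`-almost all values of the latter. Its slope is an integer and its constant term
is a value of `u`. -/
theorem exists_eventually_map_ratFunc_eval {K F : Type*} [Field K] [Field F] [Algebra K F]
    [IsAlgClosed F] {v : AddValuation K (WithTop ℝ)} {u : AddValuation F (WithTop ℝ)}
    (hu : ∀ x : K, u (algebraMap K F x) = v x) (β : F) {l : Filter (WithTop ℝ)} [l.NeBot]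
    (hl : ∀ α : F, (∀ᶠ t in l, t < u (β - α)) ∨ ∀ᶠ t in l, u (β - α) < t)
    {φ : RatFunc K} (hφ : φ ≠ 0) :
    ∃ (y : F) (c : ℝ) (k : ℤ), u y = (c : WithTop ℝ) ∧
      ∀ᶠ t in l, ∀ (x : K) (r : ℝ), u (β - algebraMap K F x) = t → t = (r : WithTop ℝ) →
        φ.denom.eval x ≠ 0 ∧ v (φ.eval (RingHom.id K) x) = ((c + k * r : ℝ) : WithTop ℝ) := by
  have key : ∀ p : Polynomial K, p ≠ 0 → ∃ (y : F) (c : ℝ) (k : ℕ), u y = (c : WithTop ℝ) ∧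
      ∀ᶠ t in l, ∀ (x : K) (r : ℝ), u (β - algebraMap K F x) = t → t = (r : WithTop ℝ) →
        v (p.eval x) = ((c + k * r : ℝ) : WithTop ℝ) := by
    intro p hp
    obtain ⟨y, k, hy, h⟩ := (IsAlgClosed.splits
      (p.map (algebraMap K F))).exists_eventually_map_eval u β hl
      (Polynomial.map_ne_zero hp)
    obtain ⟨c, hc⟩ := u.exists_coe_eq hy
    refine ⟨y, c, k, hc, h.mono fun t ht x r hx hr => ?_⟩
    have := ht _ hx
    rwa [Polynomial.eval_map_algebraMap, Polynomial.aeval_algebraMap_apply,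
      Polynomial.coe_aeval_eq_eval, hu, hc, hr, ← WithTop.coe_nsmul, nsmul_eq_mul,
      ← WithTop.coe_add] at this
  obtain ⟨y, c, k, hy, h⟩ := key φ.num (RatFunc.num_ne_zero hφ)
  obtain ⟨y', c', k', hy', h'⟩ := key φ.denom φ.denom_ne_zero
  refine ⟨y / y', c - c', k - k', ?_, ?_⟩
  · rw [AddValuation.map_div, hy, hy']
    rfl
  · filter_upwards [h, h'] with t h h' x r hx hr
    have hd := h' x r hx hr
    refine ⟨v.ne_zero_of_eq_coe hd, ?_⟩
    rw [RatFunc.eval, ← Polynomial.eval, ← Polynomial.eval, AddValuation.map_div, hd, h x r hx hr,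
      ← WithTop.LinearOrderedAddCommGroup.coe_sub]
    congr 1
    push_cast
    ring

/-! ### Breadth and pseudo-limits -/

section PseudoConvergent

variable {K : Type*} [Field K] {v : AddValuation K (WithTop ℝ)} {s : ℕ → K}

lemma IsPseudoConvergent.strictMono (hs : IsPseudoConvergent v s) :
    StrictMono fun n => v (s (n + 1) - s n) :=
  strictMono_nat_of_lt_succ hs

lemma IsPseudoConvergent.lt_breadth (hs : IsPseudoConvergent v s) (n : ℕ) :
    v (s (n + 1) - s n) < breadth v s :=
  (hs n).trans_le (hs.strictMono.monotone.ge_of_tendsto hs.tendsto_breadth (n + 1))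

lemma IsPseudoConvergent.exists_coe_eq (hs : IsPseudoConvergent v s) (n : ℕ) :
    ∃ r : ℝ, v (s (n + 1) - s n) = (r : WithTop ℝ) := by
  obtain ⟨r, hr⟩ := WithTop.ne_top_iff_exists.1 (hs n).ne_top
  exact ⟨r, hr.symm⟩

lemma IsPseudoConvergent.map_sub_eq (hs : IsPseudoConvergent v s) {m n : ℕ} (hmn : m < n) :
    v (s n - s m) = v (s (m + 1) - s m) := by
  induction n, hmn using Nat.le_induction with
  | base => rfl
  | succ n hn ih =>
    have h : v (s n - s m) < v (s (n + 1) - s n) := by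
      rw [ih]
      exact hs.strictMono hn
    rw [show s (n + 1) - s m = (s n - s m) + (s (n + 1) - s n) by ring,
      v.map_add_eq_of_lt_left h, ih]

end PseudoConvergent

section PseudoLimit

variable {K F : Type*} [Field K] [Field F] [Algebra K F] {v : AddValuation K (WithTop ℝ)}
  {u : AddValuation F (WithTop ℝ)} {s : ℕ → K} {β : F}

lemma IsPseudoLimit.map_sub_eq (hu : ∀ x : K, u (algebraMap K F x) = v x)
    (hβ : IsPseudoLimit u s β) (n : ℕ) :
    u (β - algebraMap K F (s n)) = v (s (n + 1) - s n) := by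
  rw [← hu, ← u.map_sub_eq_of_lt_left (hβ n), map_sub (algebraMap K F)]
  congr 1
  ring

lemma breadth_le_distToBase (hu : ∀ x : K, u (algebraMap K F x) = v x)
    (hs : IsPseudoConvergent v s) (hβ : IsPseudoLimit u s β) :
    breadth v s ≤ distToBase K u β :=
  le_of_tendsto' hs.tendsto_breadth fun n =>
    hβ.map_sub_eq hu n ▸ (isLUB_distToBase K u β).1 ⟨s n, rfl⟩

/-- Every `δ ≤ δ(β, K)` is the breadth of a pseudo-convergent sequence with pseudo-limit `β`:
perturb approximations of `β` by elements of `K` of prescribed values `γ₀ < γ₁ < ⋯ → δ`. -/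
theorem exists_breadth_eq (hu : ∀ x : K, u (algebraMap K F x) = v x)
    (hd : Dense (valueAddSubgroup v : Set ℝ)) {δ : WithTop ℝ} (hδ : δ ≤ distToBase K u β) :
    ∃ s : ℕ → K, IsPseudoConvergent v s ∧ IsPseudoLimit u s β ∧ breadth v s = δ := by
  obtain ⟨a, ha⟩ := exists_lt δ
  obtain ⟨t, ht, htmem, htend⟩ := exists_seq_strictMono_tendsto' ha
  choose c r hc hlt hgt using fun n => exists_value_between hd (ht (Nat.lt_succ_self n))
  have hr : ∀ n, (r n : WithTop ℝ) < δ := fun n => (hgt n).trans (htmem (n + 1)).2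
  have happrox : ∀ n, ∃ x : K, (r n : WithTop ℝ) < u (β - algebraMap K F x) := fun n => by
    simpa using (lt_isLUB_iff (isLUB_distToBase K u β)).1 ((hr n).trans_le hδ)
  choose x hx using happrox
  have hval : ∀ n, u (β - algebraMap K F (x n + c n)) = (r n : WithTop ℝ) := by
    intro n
    have h' : u (algebraMap K F (c n)) < u (β - algebraMap K F (x n)) := by
      rw [hu, hc]
      exact hx n
    rw [map_add (algebraMap K F), ← sub_sub, u.map_sub_eq_of_lt_right h', hu, hc]
  have hmono : ∀ n, (r n : WithTop ℝ) < r (n + 1) := fun n => (hgt n).trans (hlt (n + 1))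
  have hβ : IsPseudoLimit u (fun n => x n + c n) β := fun n => by
    rw [hval, hval]
    exact hmono n
  have hE : ∀ n, v ((x (n + 1) + c (n + 1)) - (x n + c n)) = (r n : WithTop ℝ) := fun n => by
    rw [← hβ.map_sub_eq hu, hval]
  have hs : IsPseudoConvergent v (fun n => x n + c n) := fun n => by
    rw [hE n, hE (n + 1)]
    exact hmono n
  refine ⟨_, hs, hβ, tendsto_nhds_unique hs.tendsto_breadth ?_⟩
  simp only [hE]
  exact tendsto_of_tendsto_of_tendsto_of_le_of_le htend
    (htend.comp (tendsto_add_atTop_nat 1)) (fun n => (hlt n).le) (fun n => (hgt n).le)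

/-- Membership in `V_E` is decided by the values of `φ` at the points of `K` whose distance from `β`
is below the breadth and close to it. -/
lemma mem_ringOfSeq_of_forall (hu : ∀ x : K, u (algebraMap K F x) = v x) {V : ValuationSubring K}
    (hs : IsPseudoConvergent v s) (hβ : IsPseudoLimit u s β) {φ : RatFunc K} {a b : WithTop ℝ}
    (ha : a < breadth v s) (hb : breadth v s ≤ b)
    (h : ∀ x : K, a < u (β - algebraMap K F x) → u (β - algebraMap K F x) < b →
      φ.denom.eval x ≠ 0 ∧ φ.eval (RingHom.id K) x ∈ V) : φ ∈ ringOfSeq V s := by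
  filter_upwards [hs.tendsto_breadth.eventually (lt_mem_nhds ha)] with n hn
  refine h _ ?_ ?_
  · rwa [hβ.map_sub_eq hu]
  · rw [hβ.map_sub_eq hu]
    exact (hs.lt_breadth n).trans_le hb

lemma eventually_nhdsLT_lt_or_gt (u : AddValuation F (WithTop ℝ)) (β : F) (δ : WithTop ℝ) (α : F) :
    (∀ᶠ t in 𝓝[<] δ, t < u (β - α)) ∨ ∀ᶠ t in 𝓝[<] δ, u (β - α) < t := by
  rcases lt_or_ge (u (β - α)) δ with h | h
  · exact Or.inr (mem_nhdsWithin_of_mem_nhds (lt_mem_nhds h))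
  · exact Or.inl (eventually_nhdsWithin_of_forall fun t ht => lt_of_lt_of_le ht h)

/-- At distances from `β` below `δ` and close to it, the value of `φ` is an affine function of the
distance. -/
lemma exists_forall_map_ratFunc_eval_of_lt [IsAlgClosed F]
    (hu : ∀ x : K, u (algebraMap K F x) = v x) (β : F) (δ : WithTop ℝ) {φ : RatFunc K}
    (hφ : φ ≠ 0) :
    ∃ a < δ, ∃ (c : ℝ) (k : ℤ), ∀ (x : K) (r : ℝ), u (β - algebraMap K F x) = (r : WithTop ℝ) →
      a < r → (r : WithTop ℝ) < δ →
        φ.denom.eval x ≠ 0 ∧ v (φ.eval (RingHom.id K) x) = ((c + k * r : ℝ) : WithTop ℝ) := by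
  obtain ⟨-, c, k, -, h⟩ :=
    exists_eventually_map_ratFunc_eval hu β (eventually_nhdsLT_lt_or_gt u β δ) hφ
  obtain ⟨a₀, ha₀⟩ := exists_lt δ
  obtain ⟨a, ha, hsub⟩ := (mem_nhdsLT_iff_exists_Ioo_subset' ha₀).1 h
  exact ⟨a, ha, c, k, fun x r hx h1 h2 => hsub ⟨h1, h2⟩ x r hx rfl⟩

/-- If `φ ∈ V_E`, then `φ` has values in `V` at all points of `K` whose distance from `β` lies in
`(a, l)`, where `a < δ_E ≤ l` and `l` is rational over the value group. If `δ_E` itself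
is not rational over the value group, then `l > δ_E`: the affine function `c + k t` describing the
value of `φ` near distance `δ_E` has `c` rational over the value group, hence it does not vanish at
`δ_E` unless it is constant. -/
theorem exists_forall_mem_of_mem_ringOfSeq [IsAlgClosed F] [Algebra.IsAlgebraic K F]
    (hu : ∀ x : K, u (algebraMap K F x) = v x)
    (hd : Dense (valueAddSubgroup v : Set ℝ)) {V : ValuationSubring K}
    (hv : ∀ x : K, x ∈ V ↔ 0 ≤ v x) (hs : IsPseudoConvergent v s) (hβ : IsPseudoLimit u s β)
    {φ : RatFunc K} (hmem : φ ∈ ringOfSeq V s) :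
    ∃ a l : WithTop ℝ, a < breadth v s ∧ breadth v s ≤ l ∧
      (l = ⊤ ∨ ∃ r ∈ ratValues v, l = (r : WithTop ℝ)) ∧
      ∀ x : K, a < u (β - algebraMap K F x) → u (β - algebraMap K F x) < l →
        φ.denom.eval x ≠ 0 ∧ φ.eval (RingHom.id K) x ∈ V := by
  rcases eq_or_ne φ 0 with rfl | hφ
  · refine ⟨_, ⊤, hs.lt_breadth 0, le_top, Or.inl rfl, fun x _ _ => ?_⟩
    simp [V.zero_mem]
  set δ := breadth v s with hδ
  by_cases hrat : δ = ⊤ ∨ ∃ r ∈ ratValues v, δ = (r : WithTop ℝ)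
  · obtain ⟨a, ha, c, k, h⟩ := exists_forall_map_ratFunc_eval_of_lt hu β δ hφ
    have hseq : ∀ᶠ n in atTop, ∀ r : ℝ, v (s (n + 1) - s n) = (r : WithTop ℝ) → 0 ≤ c + k * r := by
      filter_upwards [hmem, hs.tendsto_breadth.eventually (lt_mem_nhds ha)] with n hn han r hr
      have h1 := hβ.map_sub_eq hu n
      have h2 := hs.lt_breadth n
      rw [hr] at h1 h2 han
      have h3 := (hv _).1 hn.2
      rw [(h _ r h1 han h2).2] at h3
      exact_mod_cast h3
    obtain ⟨N, hall⟩ := eventually_atTop.1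
      (hseq.and (hs.tendsto_breadth.eventually (lt_mem_nhds ha)))
    have hN := fun n hn => (hall n hn).1
    have haN := (hall N le_rfl).2
    refine ⟨v (s (N + 1) - s N), δ, hs.lt_breadth N, le_rfl, hrat, fun x hx1 hx2 => ?_⟩
    obtain ⟨r, hr⟩ := WithTop.ne_top_iff_exists.1 hx2.ne_top
    rw [← hr] at hx1 hx2
    obtain ⟨h1, h2⟩ := h x r hr.symm (haN.trans hx1) hx2
    refine ⟨h1, (hv _).2 ?_⟩
    -- The distance `r` lies between two values `v (s (n + 1) - s n)` at which the
    -- affine function is `≥ 0`.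
    obtain ⟨m, hm, hmN⟩ := ((hs.tendsto_breadth.eventually (lt_mem_nhds hx2)).and
      (eventually_ge_atTop N)).exists
    obtain ⟨rN, hrN⟩ := hs.exists_coe_eq N
    obtain ⟨rm, hrm⟩ := hs.exists_coe_eq m
    have hcN := hN N le_rfl rN hrN
    have hcm := hN m hmN rm hrm
    rw [hrN] at hx1
    rw [hrm] at hm
    have hx1' : rN < r := WithTop.coe_lt_coe.1 hx1
    have hm' : r < rm := WithTop.coe_lt_coe.1 hm
    have hfin : 0 ≤ c + k * r := by
      rcases le_total 0 (k : ℝ) with hk | hk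
      · nlinarith
      · nlinarith
    rw [h2]
    exact_mod_cast hfin
  · push Not at hrat
    obtain ⟨d, hd'⟩ := WithTop.ne_top_iff_exists.1 hrat.1
    have hnot : d ∉ ratValues v := fun h => hrat.2 d h hd'.symm
    have hl : ∀ α : F, (∀ᶠ t in 𝓝 δ, t < u (β - α)) ∨ ∀ᶠ t in 𝓝 δ, u (β - α) < t := by
      intro α
      rcases lt_trichotomy (u (β - α)) δ with h | h | h
      · exact Or.inr (lt_mem_nhds h)
      · rw [← hd'] at h
        exact absurd (mem_ratValues_of_isAlgebraic hu (Algebra.IsAlgebraic.isAlgebraic _) h) hnot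
      · exact Or.inl (gt_mem_nhds h)
    obtain ⟨y, c, k, hy, h⟩ := exists_eventually_map_ratFunc_eval hu β hl hφ
    have hc : c ∈ ratValues v :=
      mem_ratValues_of_isAlgebraic hu (Algebra.IsAlgebraic.isAlgebraic _) hy
    have hsign : ∀ᶠ r : ℝ in 𝓝 d, (0 ≤ c + k * r ↔ 0 ≤ c + k * d) := by
      rcases eq_or_ne k 0 with rfl | hk
      · exact Eventually.of_forall fun r => by simp
      have hcont : ContinuousAt (fun r : ℝ => c + k * r) d := by fun_prop
      have hne : c + k * d ≠ 0 := by
        intro h0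
        refine hnot ?_
        have hk' : (k : ℝ) ≠ 0 := by exact_mod_cast hk
        have : d = ((-(k : ℚ)⁻¹ : ℚ) : ℝ) * c := by
          push_cast
          field_simp
          linarith
        rw [this]
        exact mul_mem_ratValues hc _
      rcases lt_or_gt_of_ne hne with h0 | h0
      · filter_upwards [hcont.eventually (gt_mem_nhds h0)] with r hr
        exact iff_of_false hr.not_ge h0.not_ge
      · filter_upwards [hcont.eventually (lt_mem_nhds h0)] with r hr
        exact iff_of_true hr.le h0.le
    obtain ⟨a₁, b₁, hd₁, hsub₁⟩ := mem_nhds_iff_exists_Ioo_subset.1 hsign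
    obtain ⟨a₀, ha₀⟩ := exists_lt δ
    obtain ⟨a₂, b₂, hd₂, hsub₂⟩ := (mem_nhds_iff_exists_Ioo_subset'
      ⟨a₀, ha₀⟩ ⟨⊤, lt_top_iff_ne_top.2 hrat.1⟩).1 h
    have hlow : max (a₁ : WithTop ℝ) a₂ < δ :=
      max_lt (hd' ▸ WithTop.coe_lt_coe.2 hd₁.1) hd₂.1
    have hup : δ < min (b₁ : WithTop ℝ) b₂ :=
      lt_min (hd' ▸ WithTop.coe_lt_coe.2 hd₁.2) hd₂.2
    have hform : ∀ (x : K) (r : ℝ), u (β - algebraMap K F x) = (r : WithTop ℝ) →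
        max (a₁ : WithTop ℝ) a₂ < r → (r : WithTop ℝ) < min (b₁ : WithTop ℝ) b₂ →
        φ.denom.eval x ≠ 0 ∧ (φ.eval (RingHom.id K) x ∈ V ↔ 0 ≤ c + k * d) := by
      intro x r hx h1 h2
      rw [max_lt_iff] at h1
      rw [lt_min_iff] at h2
      obtain ⟨h3, h4⟩ := hsub₂ ⟨h1.2, h2.2⟩ x r hx rfl
      refine ⟨h3, ?_⟩
      rw [hv, h4, ← WithTop.coe_zero, WithTop.coe_le_coe]
      exact hsub₁ ⟨WithTop.coe_lt_coe.1 h1.1, WithTop.coe_lt_coe.1 h2.1⟩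
    have hpos : 0 ≤ c + k * d := by
      obtain ⟨n, hn, han⟩ := (Eventually.and hmem
        (hs.tendsto_breadth.eventually (lt_mem_nhds hlow))).exists
      obtain ⟨r, hr⟩ := hs.exists_coe_eq n
      have h2 := (hs.lt_breadth n).trans hup
      rw [hr] at han h2
      exact (hform _ r ((hβ.map_sub_eq hu n).trans hr) han h2).2.1 hn.2
    obtain ⟨z, l, hz, hl1, hl2⟩ := exists_value_between hd hup
    refine ⟨_, l, hlow, hl1.le, Or.inr ⟨l, coe_mem_ratValues hz, rfl⟩, fun x hx1 hx2 => ?_⟩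
    obtain ⟨r, hr⟩ := WithTop.ne_top_iff_exists.1 hx2.ne_top
    rw [← hr] at hx1 hx2
    obtain ⟨h1, h2⟩ := hform x r hr.symm hx1 (hx2.trans hl2)
    exact ⟨h1, h2.2 hpos⟩

/-- `V_E` is a valuation domain of `K(X)` containing `V`, because the value of a rational function
along `E` is eventually a monotone or antitone function of the index. -/
theorem exists_ring_eq_ringOfSeq [IsAlgClosed F]
    (hu : ∀ x : K, u (algebraMap K F x) = v x) {V : ValuationSubring K}
    (hv : ∀ x : K, x ∈ V ↔ 0 ≤ v x) (hs : IsPseudoConvergent v s) (hβ : IsPseudoLimit u s β) :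
    ∃ W : Zar V (RatFunc K), (W.ring : Set (RatFunc K)) = ringOfSeq V s := by
  have hadd : ∀ {φ ψ : RatFunc K}, φ ∈ ringOfSeq V s → ψ ∈ ringOfSeq V s →
      φ + ψ ∈ ringOfSeq V s := by
    intro φ ψ hφ hψ
    filter_upwards [hφ, hψ] with n h1 h2
    refine ⟨fun h => ?_, ?_⟩
    · have := Polynomial.eval_eq_zero_of_dvd_of_eval_eq_zero (RatFunc.denom_add_dvd φ ψ) h
      rw [Polynomial.eval_mul] at this
      exact (mul_ne_zero h1.1 h2.1) this
    · rw [RatFunc.eval_add _ _ h1.1 h2.1]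
      exact V.add_mem _ _ h1.2 h2.2
  have hmul : ∀ {φ ψ : RatFunc K}, φ ∈ ringOfSeq V s → ψ ∈ ringOfSeq V s →
      φ * ψ ∈ ringOfSeq V s := by
    intro φ ψ hφ hψ
    filter_upwards [hφ, hψ] with n h1 h2
    refine ⟨fun h => ?_, ?_⟩
    · have := Polynomial.eval_eq_zero_of_dvd_of_eval_eq_zero (RatFunc.denom_mul_dvd φ ψ) h
      rw [Polynomial.eval_mul] at this
      exact (mul_ne_zero h1.1 h2.1) this
    · rw [RatFunc.eval_mul _ _ h1.1 h2.1]
      exact V.mul_mem _ _ h1.2 h2.2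
  have hC : ∀ x ∈ V, RatFunc.C x ∈ ringOfSeq V s := fun x hx =>
    Eventually.of_forall fun n => by simpa [RatFunc.denom_C] using hx
  have hone : (1 : RatFunc K) ∈ ringOfSeq V s := by simpa using hC 1 V.one_mem
  have hneg : (-1 : RatFunc K) ∈ ringOfSeq V s := by simpa using hC (-1) (V.neg_mem _ V.one_mem)
  have htotal : ∀ φ : RatFunc K, φ ∈ ringOfSeq V s ∨ φ⁻¹ ∈ ringOfSeq V s := by
    intro φ
    rcases eq_or_ne φ 0 with rfl | hφ
    · exact Or.inl (by simpa using hC 0 V.zero_mem)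
    obtain ⟨a, ha, c, k, h⟩ := exists_forall_map_ratFunc_eval_of_lt hu β (breadth v s) hφ
    obtain ⟨a', ha', c', k', h'⟩ :=
      exists_forall_map_ratFunc_eval_of_lt hu β (breadth v s) (inv_ne_zero hφ)
    choose r hr using hs.exists_coe_eq
    have hrmono : Monotone r := fun m n hmn => by
      have := hs.strictMono.monotone hmn
      simp only [hr] at this
      exact_mod_cast this
    have hden : ∀ᶠ n in atTop, φ.denom.eval (s n) ≠ 0 ∧ φ⁻¹.denom.eval (s n) ≠ 0 ∧
        (φ.eval (RingHom.id K) (s n) ∈ V ↔ 0 ≤ c + k * r n) := by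
      filter_upwards [hs.tendsto_breadth.eventually (lt_mem_nhds ha),
        hs.tendsto_breadth.eventually (lt_mem_nhds ha')] with n h1 h2
      have h3 := hs.lt_breadth n
      rw [hr] at h1 h2 h3
      have h4 := h (s n) (r n) ((hβ.map_sub_eq hu n).trans (hr n)) h1 h3
      refine ⟨h4.1, (h' (s n) (r n) ((hβ.map_sub_eq hu n).trans (hr n)) h2 h3).1, ?_⟩
      rw [hv, h4.2, ← WithTop.coe_zero, WithTop.coe_le_coe]
    -- The affine function is monotone or antitone along the sequence.
    have hsign : (∀ᶠ n in atTop, 0 ≤ c + k * r n) ∨ ∀ᶠ n in atTop, ¬ 0 ≤ c + k * r n := by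
      by_contra hcon
      rw [not_or, not_eventually, not_eventually] at hcon
      simp only [not_not] at hcon
      obtain ⟨hneg, hpos⟩ := hcon
      rcases le_total 0 (k : ℝ) with hk | hk
      · obtain ⟨n, hn⟩ := hpos.exists
        obtain ⟨m, hm, hmn⟩ := (hneg.and_eventually (eventually_ge_atTop n)).exists
        exact hm (hn.trans (by gcongr; exact hrmono hmn))
      · obtain ⟨n, hn⟩ := hneg.exists
        obtain ⟨m, hm, hmn⟩ := (hpos.and_eventually (eventually_ge_atTop n)).exists
        exact hn (hm.trans (by
          have := mul_le_mul_of_nonpos_left (hrmono hmn) hk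
          linarith))
    rcases hsign with hpos | hneg
    · left
      filter_upwards [hden, hpos] with n h1 h2
      exact ⟨h1.1, h1.2.2.2 h2⟩
    · right
      filter_upwards [hden, hneg] with n h1 h2
      refine ⟨h1.2.1, ?_⟩
      have hinv : φ.eval (RingHom.id K) (s n) * φ⁻¹.eval (RingHom.id K) (s n) = 1 := by
        rw [← RatFunc.eval_mul _ _ h1.1 h1.2.1, mul_inv_cancel₀ hφ, RatFunc.eval_one]
      rw [eq_inv_of_mul_eq_one_right hinv]
      exact (V.mem_or_inv_mem _).resolve_left fun hmem => h2 (h1.2.2.1 hmem)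
  let W : ValuationSubring (RatFunc K) :=
    { carrier := ringOfSeq V s
      mul_mem' := hmul
      one_mem' := hone
      add_mem' := hadd
      zero_mem' := by simpa using hC 0 V.zero_mem
      neg_mem' := fun {φ} hφ => by simpa using hmul hneg hφ
      mem_or_inv_mem' := htotal }
  exact ⟨⟨W, fun x hx => hC x hx⟩, rfl⟩

end PseudoLimit

/-! ### Rational functions detecting the breadth -/

section Detect

variable {K : Type*} [Field K] {v : AddValuation K (WithTop ℝ)} {s : ℕ → K}

lemma linear_mem_ringOfSeq_iff {V : ValuationSubring K} (hv : ∀ x : K, x ∈ V ↔ 0 ≤ v x)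
    {a c : K} {r : ℝ} (hc : v c = (r : WithTop ℝ)) :
    algebraMap (Polynomial K) (RatFunc K)
        (Polynomial.C c⁻¹ * (Polynomial.X - Polynomial.C a)) ∈ ringOfSeq V s ↔
      ∀ᶠ n in atTop, (r : WithTop ℝ) ≤ v (s n - a) := by
  refine eventually_congr (Eventually.of_forall fun n => ?_)
  have hc0 := v.ne_zero_of_eq_coe hc
  have heval : (algebraMap (Polynomial K) (RatFunc K)
      (Polynomial.C c⁻¹ * (Polynomial.X - Polynomial.C a))).eval (RingHom.id K) (s n) =
      c⁻¹ * (s n - a) := by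
    rw [RatFunc.eval_algebraMap]
    simp
  rw [heval, hv, RatFunc.denom_algebraMap]
  simp only [Polynomial.eval_one, ne_eq, one_ne_zero, not_false_eq_true, true_and]
  have hmul : v (s n - a) = r + v (c⁻¹ * (s n - a)) := by
    rw [← hc, ← v.map_mul, mul_inv_cancel_left₀ hc0]
  rw [hmul]
  refine ⟨fun h => le_add_of_nonneg_right h, fun h => ?_⟩
  by_contra! hlt
  exact absurd h (not_le.2 (by
    obtain ⟨q, hq⟩ := WithTop.ne_top_iff_exists.1 hlt.ne_top
    rw [← hq] at hlt ⊢
    have : q < 0 := by exact_mod_cast hlt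
    exact_mod_cast (by linarith : r + q < r)))

/-- The sets `{W | (X - a) / c ∈ W}` with `v c > α` detect whether the breadth is above `α`. -/
lemma IsPseudoConvergent.exists_linear_mem {V : ValuationSubring K}
    (hv : ∀ x : K, x ∈ V ↔ 0 ≤ v x) (hs : IsPseudoConvergent v s) {α : WithTop ℝ}
    (hα : α < breadth v s) :
    ∃ φ ∈ ringOfSeq V s, ∀ t : ℕ → K, IsPseudoConvergent v t → φ ∈ ringOfSeq V t →
      α < breadth v t := by
  obtain ⟨m, hm⟩ := (hs.tendsto_breadth.eventually (lt_mem_nhds hα)).exists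
  obtain ⟨r, hr⟩ := hs.exists_coe_eq m
  refine ⟨_, (linear_mem_ringOfSeq_iff hv (a := s m) hr).2 ?_, fun t ht hmem => ?_⟩
  · filter_upwards [eventually_gt_atTop m] with n hn
    rw [hs.map_sub_eq hn, hr]
  · rw [linear_mem_ringOfSeq_iff hv hr, eventually_atTop] at hmem
    obtain ⟨N, hN⟩ := hmem
    have h1 : (r : WithTop ℝ) ≤ v (t (N + 1) - t N) := by
      rw [show t (N + 1) - t N = (t (N + 1) - s m) - (t N - s m) by ring]
      exact v.map_le_sub (hN _ (Nat.le_succ N)) (hN N le_rfl)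
    rw [hr] at hm
    exact hm.trans (h1.trans_lt (ht.lt_breadth N))

theorem breadth_eq_of_ringOfSeq_eq {V : ValuationSubring K} (hv : ∀ x : K, x ∈ V ↔ 0 ≤ v x)
    {t : ℕ → K} (hs : IsPseudoConvergent v s) (ht : IsPseudoConvergent v t)
    (h : ringOfSeq V s = ringOfSeq V t) : breadth v s = breadth v t := by
  refine le_antisymm (le_of_forall_lt fun α hα => ?_) (le_of_forall_lt fun α hα => ?_)
  · obtain ⟨φ, hφ, hφ'⟩ := hs.exists_linear_mem hv hα
    exact hφ' t ht (h ▸ hφ)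
  · obtain ⟨φ, hφ, hφ'⟩ := ht.exists_linear_mem hv hα
    exact hφ' s hs (h.symm ▸ hφ)

lemma exists_mul_mem_of_mem_ratValues {l : ℝ} (hl : l ∈ ratValues v) :
    ∃ (m : ℕ) (c : K), m ≠ 0 ∧ v c = ((m * l : ℝ) : WithTop ℝ) := by
  obtain ⟨q, γ, hγ, rfl⟩ := hl
  obtain ⟨c, hc⟩ : q.num • γ ∈ valueAddSubgroup v :=
    zsmul_mem (show γ ∈ valueAddSubgroup v from hγ) _
  refine ⟨q.den, c, q.den_nz, hc.trans ?_⟩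
  congr 1
  rw [zsmul_eq_mul, ← mul_assoc]
  congr 1
  have := Rat.den_mul_eq_num q
  exact_mod_cast this.symm

/-- The rational function `c / (X - x)ᵐ` with `v c = m l`, where `x ∈ K` is closer to `β`
than `l ∈ ℚΓ_v`, detects whether the breadth of a sequence with pseudo-limit `β` is at most `l`. If
there is no such `x`, then every breadth is at most `l`, and `0` serves. -/
theorem exists_mem_ringOfSeq_iff_breadth_le {F : Type*} [Field F] [Algebra K F]
    {u : AddValuation F (WithTop ℝ)} {β : F} (hu : ∀ x : K, u (algebraMap K F x) = v x)
    {V : ValuationSubring K} (hv : ∀ x : K, x ∈ V ↔ 0 ≤ v x) {l : WithTop ℝ}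
    (hl : l = ⊤ ∨ ∃ r ∈ ratValues v, l = (r : WithTop ℝ)) :
    ∃ φ : RatFunc K, ∀ s : ℕ → K, IsPseudoConvergent v s → IsPseudoLimit u s β →
      (φ ∈ ringOfSeq V s ↔ breadth v s ≤ l) := by
  rcases le_or_gt (distToBase K u β) l with hle | hlt
  · refine ⟨0, fun s hs hβ => iff_of_true (Eventually.of_forall fun n => ?_)
      ((breadth_le_distToBase hu hs hβ).trans hle)⟩
    simp [V.zero_mem]
  obtain ⟨l, hlmem, rfl⟩ := hl.resolve_left hlt.ne_top
  obtain ⟨m, c, hm, hc⟩ := exists_mul_mem_of_mem_ratValues hlmem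
  obtain ⟨x, hx⟩ : ∃ x : K, (l : WithTop ℝ) < u (β - algebraMap K F x) := by
    simpa using (lt_isLUB_iff (isLUB_distToBase K u β)).1 hlt
  let q : Polynomial K := (Polynomial.X - Polynomial.C x) ^ m
  have hq0 : q ≠ 0 := pow_ne_zero _ (Polynomial.X_sub_C_ne_zero x)
  have hqeval : ∀ z, q.eval z = (z - x) ^ m := fun z => by simp [q]
  let φ : RatFunc K := algebraMap (Polynomial K) (RatFunc K) (Polynomial.C c) /
    algebraMap (Polynomial K) (RatFunc K) q
  have hden : ∀ z, z ≠ x → φ.denom.eval z ≠ 0 := by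
    intro z hz h
    have := Polynomial.eval_eq_zero_of_dvd_of_eval_eq_zero
      (RatFunc.denom_div_dvd (Polynomial.C c) q) h
    rw [hqeval] at this
    exact pow_ne_zero _ (sub_ne_zero.2 hz) this
  have heval : ∀ z, z ≠ x → φ.eval (RingHom.id K) z * (z - x) ^ m = c := by
    intro z hz
    have hmul : φ * algebraMap (Polynomial K) (RatFunc K) q =
        algebraMap (Polynomial K) (RatFunc K) (Polynomial.C c) :=
      div_mul_cancel₀ _ (RatFunc.algebraMap_ne_zero hq0)
    have h1 := RatFunc.eval_mul (RingHom.id K) z (x := φ)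
      (y := algebraMap (Polynomial K) (RatFunc K) q) (hden z hz) (by simp)
    rw [hmul, RatFunc.eval_algebraMap, RatFunc.eval_algebraMap] at h1
    rw [← hqeval]
    simpa using h1.symm
  have hmem : ∀ z r, z ≠ x → v (z - x) = ((r : ℝ) : WithTop ℝ) →
      (φ.eval (RingHom.id K) z ∈ V ↔ r ≤ l) := by
    intro z r hz hr
    have h1 := congrArg v (heval z hz)
    have hφ0 : φ.eval (RingHom.id K) z ≠ 0 := fun h =>
      v.ne_zero_of_eq_coe hc (by rw [← heval z hz, h, zero_mul])
    obtain ⟨w, hw⟩ := v.exists_coe_eq hφ0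
    rw [v.map_mul, v.map_pow, hr, hw, hc, ← WithTop.coe_nsmul, nsmul_eq_mul, ← WithTop.coe_add,
      WithTop.coe_inj] at h1
    rw [hv, hw, ← WithTop.coe_zero, WithTop.coe_le_coe]
    have hm' : (0 : ℝ) < m := by exact_mod_cast Nat.pos_of_ne_zero hm
    have h2 : w = m * (l - r) := by linarith
    rw [h2, mul_nonneg_iff_of_pos_left hm', sub_nonneg]
  refine ⟨φ, fun s hs hβ => ⟨fun hφ => ?_, fun hle => ?_⟩⟩
  · by_contra! hgt
    -- A sequence of breadth above `l` eventually has `φ (s n) ∉ V` unless `s n = x`,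
    -- and it cannot be eventually constant.
    obtain ⟨N, hN⟩ := eventually_atTop.1
      (Eventually.and hφ (hs.tendsto_breadth.eventually (lt_mem_nhds hgt)))
    have hno : ∀ n ≥ N, s n = x := by
      intro n hn
      by_contra hne
      obtain ⟨r, hr⟩ := v.exists_coe_eq (sub_ne_zero.2 hne)
      have h1 : (l : WithTop ℝ) < v (s n - x) := by
        rw [← hu, map_sub (algebraMap K F), show algebraMap K F (s n) - algebraMap K F x =
          (β - algebraMap K F x) - (β - algebraMap K F (s n)) by ring]
        refine (lt_min hx ?_).trans_le (u.map_sub _ _)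
        rw [hβ.map_sub_eq hu]
        exact (hN n hn).2
      rw [hr, WithTop.coe_lt_coe] at h1
      exact h1.not_ge ((hmem _ r hne hr).1 (hN n hn).1.2)
    obtain ⟨r, hr⟩ := hs.exists_coe_eq N
    rw [hno N le_rfl, hno (N + 1) (Nat.le_succ N), sub_self] at hr
    simp at hr
  · refine Eventually.of_forall fun n => ?_
    obtain ⟨r, hr⟩ := hs.exists_coe_eq n
    have hlt' := (hs.lt_breadth n).trans_le hle
    have h1 : v (s n - x) = (r : WithTop ℝ) := by
      rw [← hu, map_sub (algebraMap K F), show algebraMap K F (s n) - algebraMap K F x =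
          (β - algebraMap K F x) - (β - algebraMap K F (s n)) by ring,
        u.map_sub_eq_of_lt_right, hβ.map_sub_eq hu, hr]
      rw [hβ.map_sub_eq hu]
      exact hlt'.trans hx
    have hne : s n ≠ x := sub_ne_zero.1 (v.ne_zero_of_eq_coe h1)
    rw [hr, WithTop.coe_lt_coe] at hlt'
    exact ⟨hden _ hne, (hmem _ r hne h1).2 hlt'.le⟩

end Detect

/-! ### The homeomorphism -/

theorem mainTheorem2 {K : Type*} [Field K] (V : ValuationSubring K)
    (hrank : ringKrullDim V = 1) (hdisc : ¬ IsDiscreteValuationRing V)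
    (v : AddValuation K (WithTop ℝ)) (hv : ∀ x : K, x ∈ V ↔ 0 ≤ v x)
    {Kbar : Type*} [Field Kbar] [Algebra K Kbar] [IsAlgClosure K Kbar]
    (u : AddValuation Kbar (WithTop ℝ)) (hu : ∀ x : K, u (algebraMap K Kbar x) = v x)
    (β : Kbar) :
    (∀ s : ℕ → K, IsPseudoConvergent v s → IsPseudoLimit u s β →
      ∃ W ∈ fixedPseudoLimit V v u β, (W.ring : Set (RatFunc K)) = ringOfSeq V s) ∧
    ∃ Sigma : fixedPseudoLimit V v u β ≃ₜ UpperLimit (distToBase K u β) (ratValues v),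
      ∀ (W : fixedPseudoLimit V v u β) (s : ℕ → K), IsPseudoConvergent v s →
        (W.1.ring : Set (RatFunc K)) = ringOfSeq V s → (Sigma W).val = breadth v s := by
  have : IsAlgClosed Kbar := IsAlgClosure.isAlgClosed K
  have : Algebra.IsAlgebraic K Kbar := IsAlgClosure.isAlgebraic
  have hd := dense_valueAddSubgroup V hrank hdisc v hv
  have hpoint : ∀ s : ℕ → K, IsPseudoConvergent v s → IsPseudoLimit u s β →
      ∃ W ∈ fixedPseudoLimit V v u β, (W.ring : Set (RatFunc K)) = ringOfSeq V s := by
    intro s hs hβ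
    obtain ⟨W, hW⟩ := exists_ring_eq_ringOfSeq hu hv hs hβ
    exact ⟨W, ⟨s, hs, hβ, hW⟩, hW⟩
  refine ⟨hpoint, ?_⟩
  choose E hE hEβ hEring using fun W : fixedPseudoLimit V v u β => W.2
  have hmem : ∀ (W : fixedPseudoLimit V v u β) (φ : RatFunc K),
      φ ∈ W.1.ring ↔ φ ∈ ringOfSeq V (E W) := fun W φ => by rw [← hEring W]; rfl
  let S : fixedPseudoLimit V v u β → UpperLimit (distToBase K u β) (ratValues v) :=
    fun W => ⟨breadth v (E W), breadth_le_distToBase hu (hE W) (hEβ W)⟩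
  have hinj : Function.Injective S := by
    intro W W' h
    have hb : breadth v (E W) = breadth v (E W') := congrArg UpperLimit.val h
    have hsub : ∀ W W' : fixedPseudoLimit V v u β, breadth v (E W) = breadth v (E W') →
        ∀ φ ∈ W.1.ring, φ ∈ W'.1.ring := by
      intro W W' hb φ hφ
      rw [hmem] at hφ ⊢
      obtain ⟨a, l, ha, hl, -, h⟩ := exists_forall_mem_of_mem_ringOfSeq hu hd hv (hE W) (hEβ W) hφ
      exact mem_ringOfSeq_of_forall hu (hE W') (hEβ W') (hb ▸ ha) (hb ▸ hl) h
    exact Subtype.ext (Subtype.ext (SetLike.ext fun φ => ⟨hsub W W' hb φ, hsub W' W hb.symm φ⟩))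
  have hbreadth : ∀ (W : fixedPseudoLimit V v u β) (s : ℕ → K), IsPseudoConvergent v s →
      (W.1.ring : Set (RatFunc K)) = ringOfSeq V s → (S W).val = breadth v s := fun W s hs hW =>
    breadth_eq_of_ringOfSeq_eq hv (hE W) hs ((hEring W).symm.trans hW)
  have hsurj : Function.Surjective S := by
    rintro ⟨δ, hδ⟩
    obtain ⟨s, hs, hβ, rfl⟩ := exists_breadth_eq hu hd hδ
    obtain ⟨W, hW, hWring⟩ := hpoint s hs hβ
    exact ⟨⟨W, hW⟩, UpperLimit.ext (hbreadth ⟨W, hW⟩ s hs hWring)⟩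
  have hopen : ∀ φ : RatFunc K,
      IsOpen {W : fixedPseudoLimit V v u β | φ ∈ ringOfSeq V (E W)} := by
    intro φ
    have h : IsOpen (Zar.basicOpen V φ) := TopologicalSpace.isOpen_generateFrom_of_mem ⟨φ, rfl⟩
    convert h.preimage continuous_subtype_val using 1
    ext W
    exact (hmem W φ).symm
  have hcont : Continuous S := by
    refine continuous_generateFrom_iff.2 ?_
    rintro _ ⟨α, l, -, hl, rfl⟩
    refine IsOpen.inter (s := {W | α < breadth v (E W)}) (t := {W | breadth v (E W) ≤ l}) ?_ ?_
    · refine isOpen_iff_mem_nhds.2 fun W hW => ?_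
      obtain ⟨φ, hφ, hφ'⟩ := (hE W).exists_linear_mem hv hW
      filter_upwards [(hopen φ).mem_nhds hφ] with W' hW'
      exact hφ' _ (hE W') hW'
    · obtain ⟨φ, hφ⟩ := exists_mem_ringOfSeq_iff_breadth_le (β := β) hu hv hl
      convert hopen φ using 1
      ext W
      exact (hφ _ (hE W) (hEβ W)).symm
  let e := Equiv.ofBijective S ⟨hinj, hsurj⟩
  have hcont' : Continuous e.symm := by
    refine continuous_induced_rng.2 (continuous_generateFrom_iff.2 ?_)
    rintro _ ⟨φ, rfl⟩
    refine isOpen_iff_mem_nhds.2 fun δ hδ => ?_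
    obtain ⟨W, rfl⟩ := e.surjective δ
    have hφ : φ ∈ ringOfSeq V (E W) := by
      rw [← hmem]
      simpa [Zar.basicOpen] using hδ
    obtain ⟨a, l, ha, hl, hlrat, h⟩ :=
      exists_forall_mem_of_mem_ringOfSeq hu hd hv (hE W) (hEβ W) hφ
    have hopen' : IsOpen {x : UpperLimit (distToBase K u β) (ratValues v) |
        a < x.val ∧ x.val ≤ l} :=
      TopologicalSpace.isOpen_generateFrom_of_mem
        ⟨a, l, (ha.trans_le (e W).le_bound).le, hlrat, rfl⟩
    filter_upwards [hopen'.mem_nhds (show e W ∈ _ from ⟨ha, hl⟩)] with δ' hδ'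
    obtain ⟨W', rfl⟩ := e.surjective δ'
    have hφ' := mem_ringOfSeq_of_forall hu (hE W') (hEβ W') hδ'.1 hδ'.2 h
    rw [← hmem] at hφ'
    simpa [Zar.basicOpen] using hφ'
  exact ⟨⟨e, hcont, hcont'⟩, hbreadth⟩
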